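/- **Theorem (Diffuse commutative orbit trapping).** Let $\mathcal M\subseteq B(H)$ be a von Neumann algebra with unit $I$ and let $T:\mathcal M\to\mathcal M$ be a normal (i.e. preserving infima of decreasing nets) positive linear map with $T(I)\le I$. Put $d:=I-T(I)\ge 0$ and $n_T:=\min\{n\ge 1: T^n(d)=0\}$ (with $n_T=\infty$ if there is no such $n$). Let $C\subseteq\mathcal M$ be an abelian von Neumann subalgebra (containing $I$) with a normal conditional expectation $E_C:\mathcal M\to C$, and assume that $T^k(d)\in C$ for all $k\ge 0$. Let $P:=E_C\circ T|_C:C\to C$, and let $C\cong L^\infty(X,\mu)$ be a $*$-isomorphism for a measure space $(X,\mu)$. Say that a sub-Markov kernel $K$ on $X$ (a measurable kernel with $K(x,X)\le 1$ for all $x$) implements $P$ if, for every bounded measurable $f\ge 0$, $$(Pf)(x)=\int f(y)\,K(x,dy)\quad\text{for }\mu\text{-a.e. }x .$$ 1. $T^k(d)=P^k(d)$ for all $k\ge 0$. 2. If $X$ is a standard Borel space and $\mu$ is $s$-finite (e.g. $\sigma$-finite), then there is a sub-Markov kernel $K$ on $X$ that implements $P$. 3. Let $K$ be any sub-Markov kernel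 that implements $P$, and let $A\subseteq X$ be a measurable set that agrees up to a $\mu$-null set with $\operatorname{supp}(d)=\{x:d(x)\neq 0\}$. Let $K^{(n)}$ be the $n$-fold composition of $K$ with itself, $K^{(0)}(x,\cdot)=\delta_x$. Then for every $n\ge 0$ $$P^n(d)=0\iff \mu\big(\{x\in X:K^{(n)}(x,A)>0\}\big)=0 .$$ 4. With $K$ and $A$ as in 3, $n_T<\infty$ if and only if there is $N$ such that every $n$ for which there are positive-mass paths of length $n$ starting in $A$ satisfies $n\le N$. Here the path relation induced by $K$ has an edge from $y$ to $x$ when $K(x,\cdot)$ charges $y$, and there are positive-mass paths of length $n$ starting in $A$ if the set of paths $(x_0,\dots,x_n)\in X^{n+1}$ with $x_0\in A$ has positive measure under $\mu(dx_n)\,K(x_n,dx_{n-1})\cdots K(x_1,dx_0)$. -/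

import Mathlib

open MeasureTheory ProbabilityTheory
open scoped ENNReal

noncomputable section

namespace OrbitTrapping

/-! ### Identifications with algebras of essentially bounded functions -/

/-- An identification `C ≅ L^∞(X, μ)`, that is, a `*`-isomorphism of `C` onto the algebra of classes
of essentially bounded complex functions with the almost everywhere pointwise operations. -/
structure LinftyIdentification {X : Type*} [MeasurableSpace X] (C : Type*) [Ring C] [Algebra ℂ C]
    [Star C] (μ : Measure X) extends C ≃ₗ[ℂ] Lp ℂ ∞ μ where
  map_mul : ∀ a b : C, (toFun (a * b) : X → ℂ) =ᵐ[μ] fun x => toFun a x * toFun b x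
  map_star : ∀ a : C, (toFun (star a) : X → ℂ) =ᵐ[μ] fun x => star (toFun a x)

/-- The essentially bounded function, defined up to null sets, which represents `c`. -/
def LinftyIdentification.rep {X : Type*} [MeasurableSpace X] {C : Type*} [Ring C] [Algebra ℂ C]
    [Star C] {μ : Measure X} (Φ : LinftyIdentification C μ) (c : C) : X → ℂ :=
  Φ.toLinearEquiv c

/-! ### Maps between von Neumann algebras -/

section Maps

/-- A map between partially ordered sets is normal (order continuous) if it preserves infima of
decreasing nets, that is, of nonempty downward directed sets which have an infimum. -/
def IsNormalMap {A B : Type*} [PartialOrder A] [PartialOrder B] (f : A → B) : Prop :=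
  ∀ S : Set A, S.Nonempty → DirectedOn (· ≥ ·) S → ∀ a, IsGLB S a → IsGLB (f '' S) (f a)

variable {H : Type*} [NormedAddCommGroup H] [InnerProductSpace ℂ H] [CompleteSpace H]

/-- A conditional expectation of the algebra `M` onto a subalgebra `C`: a positive linear
`C`-bimodule map which is the identity on `C`. -/
structure IsConditionalExpectation {M C : VonNeumannAlgebra H}
    (hCM : C.toStarSubalgebra ≤ M.toStarSubalgebra)
    (E : M.toStarSubalgebra →ₗ[ℂ] C.toStarSubalgebra) : Prop where
  map_nonneg : ∀ x, 0 ≤ x → 0 ≤ E x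
  map_incl : ∀ c, E (StarSubalgebra.inclusion hCM c) = c
  map_bimodule : ∀ a x b,
    E (StarSubalgebra.inclusion hCM a * x * StarSubalgebra.inclusion hCM b) = a * E x * b

/-- The defect `d(T) = I - T(I)`. -/
def defect {M : VonNeumannAlgebra H} (T : M.toStarSubalgebra →ₗ[ℂ] M.toStarSubalgebra) :
    M.toStarSubalgebra :=
  1 - T 1

/-- The stabilization index `n_T = min {n ≥ 1 : T^n(d(T)) = 0}`, with value `⊤` if there is no
such `n`. -/
def stabilizationIndex {M : VonNeumannAlgebra H}
    (T : M.toStarSubalgebra →ₗ[ℂ] M.toStarSubalgebra) : ℕ∞ :=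
  sInf {m | ∃ n : ℕ, 1 ≤ n ∧ (T ^ n) (defect T) = 0 ∧ m = n}

/-- The induced map `P = E ∘ T|_C : C → C`. -/
def inducedMap {M C : VonNeumannAlgebra H}
    (hCM : C.toStarSubalgebra ≤ M.toStarSubalgebra)
    (T : M.toStarSubalgebra →ₗ[ℂ] M.toStarSubalgebra)
    (E : M.toStarSubalgebra →ₗ[ℂ] C.toStarSubalgebra) :
    C.toStarSubalgebra →ₗ[ℂ] C.toStarSubalgebra :=
  E ∘ₗ T ∘ₗ (StarSubalgebra.inclusion hCM).toAlgHom.toLinearMap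

end Maps

/-! ### Sub-Markov kernels and their paths -/

section Kernels

variable {X : Type*} [MeasurableSpace X]

/-- A kernel all of whose measures have total mass at most one. -/
def IsSubMarkov (K : Kernel X X) : Prop := ∀ x, K x Set.univ ≤ 1

/-- Under an identification `Φ : C ≅ L^∞(X, μ)`, the map `P : C → C` is integration against the
kernel `K`: for every bounded measurable `f ≥ 0`, `(P f)(x) = ∫ f(y) K(x, dy)` for almost every
`x`. -/
def IsImplementedBy {C : Type*} [Ring C] [Algebra ℂ C] [Star C] {μ : Measure X}
    (Φ : LinftyIdentification C μ) (P : C →ₗ[ℂ] C) (K : Kernel X X) : Prop :=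
  ∀ f : X → ℝ, Measurable f → (∀ x, 0 ≤ f x) → (∃ b, ∀ x, f x ≤ b) →
    ∀ c : C, Φ.rep c =ᵐ[μ] (fun x => (f x : ℂ)) →
      Φ.rep (P c) =ᵐ[μ] fun x => ((∫ y, f y ∂(K x) : ℝ) : ℂ)

/-- The law of the `n`-step paths `(ω 0, …, ω n)` with endpoint `ω n = x`. A step of the path from
`ω i` to `ω (i + 1)` is weighted by `K (ω (i + 1), d ω i)`: in the relation induced by `K` there is
an edge from `y` to `x` when `K(x, ·)` charges `y`. -/
def pathKernel (K : Kernel X X) : (n : ℕ) → Kernel X (Fin (n + 1) → X)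
  | 0 => Kernel.deterministic (fun x _ => x) (measurable_pi_lambda _ fun _ => measurable_id)
  | n + 1 => (Kernel.id ×ₖ (pathKernel K n ∘ₖ K)).map
      fun p => (Fin.snoc p.2 p.1 : Fin (n + 2) → X)

/-- There are positive-mass paths of length `n` starting in `A`: the set of the paths
`(ω 0, …, ω n)` with `ω 0 ∈ A` has positive mass under
`μ(d ω n) K(ω n, d ω (n - 1)) ⋯ K(ω 1, d ω 0)`. -/
def HasPositiveMassPath (μ : Measure X) (K : Kernel X X) (A : Set X) (n : ℕ) : Prop :=
  0 < (μ.bind (pathKernel K n)) {ω | ω 0 ∈ A}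

end Kernels

end OrbitTrapping

end

/-! Since `E` fixes `C` pointwise and the orbit of the defect stays in `C`, induction shows that the
powers of `T` and of `P = E ∘ T|_C` agree on `d` (`coe_inducedMap_pow`).

For the kernel, `P` is positive, subunital and order continuous along decreasing sequences. The last
point needs that infimum `0` in `C` is infimum `0` in `M`, which holds because the strong limit
stays in `C` (`isGLB_range_inclusion`). Through `Φ`, infimum `0` of a decreasing sequence means
convergence to `0` almost everywhere, so `s ↦ P(1_s)` is a measure up to null sets that depend on
the sets involved. Embedding `X` in the line leaves only rational half-lines to control; a
distribution function then gives a genuine kernel (`exists_subMarkov`), and monotone approximation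
passes from indicators to bounded functions (`isImplementedBy_of_indicator`).

For any implementing kernel, `P^n d` is the integral of `d` against `K^n`. A nonnegative integral
vanishes iff the support is not charged, and a null change of the support is invisible to almost
every `K^n x` (`pow_eq_zero_iff`). The starting point of an `n`-step path ending at `x` has law `K^n
x` (`pathKernel_map_zero`), so positive-mass paths of length `n` exist iff `T^n d ≠ 0`. As `T` is
linear, an orbit that reaches `0` stays there. -/

open MeasureTheory ProbabilityTheory
open scoped ENNReal

noncomputable section

namespace OrbitTrapping

/-! ### Strong limits and order in von Neumann algebras -/

section Operators

open Filter Topology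

variable {H : Type*} [NormedAddCommGroup H] [InnerProductSpace ℂ H] [CompleteSpace H]

/-- With `s = √a`, one has `‖s x‖² = ⟨a x, x⟩` and `‖s‖² = ‖a‖`. This upgrades convergence of
quadratic forms to strong convergence. -/
lemma norm_apply_sq_le_of_nonneg {a : H →L[ℂ] H} (ha : 0 ≤ a) (x : H) :
    ‖a x‖ ^ 2 ≤ ‖a‖ * a.reApplyInnerSelf x := by
  set s := CFC.sqrt a with hs
  have hss : s * s = a := CFC.sqrt_mul_sqrt_self a ha
  have hsa : IsSelfAdjoint s := (CFC.sqrt_nonneg a).isSelfAdjoint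
  have h1 : ‖s x‖ ^ 2 = a.reApplyInnerSelf x := by
    rw [ContinuousLinearMap.reApplyInnerSelf_apply, ← hss,
      show (s * s) x = s (s x) from rfl, ← ContinuousLinearMap.adjoint_inner_right,
      ← ContinuousLinearMap.star_eq_adjoint, hsa.star_eq,
      inner_self_eq_norm_sq]
  have h2 : ‖s‖ ^ 2 = ‖a‖ := by
    rw [← hss, sq, ← CStarRing.norm_star_mul_self, hsa.star_eq]
  have h3 : ‖a x‖ ≤ ‖s‖ * ‖s x‖ := by
    rw [← hss]; exact s.le_opNorm _
  calc ‖a x‖ ^ 2 ≤ (‖s‖ * ‖s x‖) ^ 2 := by gcongr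
    _ = _ := by rw [mul_pow, h1, h2]

omit [CompleteSpace H] in
lemma reApplyInnerSelf_mono {a b : H →L[ℂ] H} (hab : a ≤ b) (x : H) :
    a.reApplyInnerSelf x ≤ b.reApplyInnerSelf x := by
  have h := ((ContinuousLinearMap.le_def a b).1 hab).re_inner_nonneg_left x
  simp only [sub_apply, inner_sub_left, map_sub] at h
  simpa [ContinuousLinearMap.reApplyInnerSelf_apply] using h

/-- A decreasing sequence of positive operators converges strongly. -/
lemma exists_tendsto_apply_of_antitone {c : ℕ → H →L[ℂ] H} (hc : Antitone c) (h0 : ∀ n, 0 ≤ c n) :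
    ∃ b : H →L[ℂ] H, ∀ x, Tendsto (fun n => c n x) atTop (𝓝 (b x)) := by
  have key : ∀ x, ∃ y, Tendsto (fun n => c n x) atTop (𝓝 y) := by
    intro x
    have hconv : CauchySeq fun n => (c n).reApplyInnerSelf x := by
      refine (tendsto_atTop_ciInf (fun m n hmn => reApplyInnerSelf_mono (hc hmn) x)
        ⟨0, ?_⟩).cauchySeq
      rintro _ ⟨n, rfl⟩
      exact ((ContinuousLinearMap.nonneg_iff_isPositive _).1 (h0 n)).2 x
    have hle : ∀ m n, m ≤ n → ‖c m x - c n x‖ ^ 2 ≤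
        ‖c 0‖ * ((c m).reApplyInnerSelf x - (c n).reApplyInnerSelf x) := by
      intro m n hmn
      have hnn : 0 ≤ c m - c n := sub_nonneg.2 (hc hmn)
      have h1 := norm_apply_sq_le_of_nonneg hnn x
      have h2 : ‖c m - c n‖ ≤ ‖c 0‖ := CStarAlgebra.norm_le_norm_of_nonneg_of_le hnn
        ((sub_le_self _ (h0 n)).trans (hc (Nat.zero_le m)))
      have h3 : (c m - c n).reApplyInnerSelf x =
          (c m).reApplyInnerSelf x - (c n).reApplyInnerSelf x := by
        simp [ContinuousLinearMap.reApplyInnerSelf_apply, inner_sub_left]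
      have h4 : 0 ≤ (c m - c n).reApplyInnerSelf x := by
        exact ((ContinuousLinearMap.nonneg_iff_isPositive _).1 hnn).2 x
      rw [h3] at h1 h4
      exact h1.trans (by gcongr)
    refine cauchySeq_tendsto_of_complete (Metric.cauchySeq_iff'.2 fun ε hε => ?_)
    -- The `+ 1` keeps the denominator positive when `c 0 = 0`.
    obtain ⟨N, hN⟩ := Metric.cauchySeq_iff'.1 hconv (ε ^ 2 / (‖c 0‖ + 1)) (by positivity)
    refine ⟨N, fun n hn => ?_⟩
    have h1 := hle N n hn
    have h2 := hN n hn
    rw [dist_comm, Real.dist_eq] at h2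
    have h3 := (le_abs_self _).trans_lt h2
    rw [lt_div_iff₀ (by positivity)] at h3
    have h5 : 0 ≤ (c N).reApplyInnerSelf x - (c n).reApplyInnerSelf x :=
      sub_nonneg.2 (reApplyInnerSelf_mono (hc hn) x)
    rw [dist_comm, dist_eq_norm]
    refine lt_of_pow_lt_pow_left₀ 2 hε.le (h1.trans_lt ?_)
    nlinarith
  choose y hy using key
  exact ⟨continuousLinearMapOfTendsto c (tendsto_pi_nhds.2 hy), hy⟩

omit [CompleteSpace H] in
lemma nonneg_of_tendsto_apply {c : ℕ → H →L[ℂ] H} {b : H →L[ℂ] H} (h0 : ∀ᶠ n in atTop, 0 ≤ c n)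
    (hb : ∀ x, Tendsto (fun n => c n x) atTop (𝓝 (b x))) : 0 ≤ b := by
  rw [ContinuousLinearMap.nonneg_iff_isPositive, ContinuousLinearMap.isPositive_iff_complex]
  intro x
  have h1 : Tendsto (fun n => inner ℂ (c n x) x) atTop (𝓝 (inner ℂ (b x) x)) :=
    (hb x).inner tendsto_const_nhds
  have h2 := (Complex.continuous_re.tendsto _).comp h1
  have h3 := h0.mono fun n hn => (ContinuousLinearMap.isPositive_iff_complex _).1
    ((ContinuousLinearMap.nonneg_iff_isPositive _).1 hn) x
  refine ⟨tendsto_nhds_unique ((Complex.continuous_ofReal.tendsto _).comp h2)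
    (h1.congr' (h3.mono fun n hn => hn.1.symm)), ge_of_tendsto h2 (h3.mono fun n hn => hn.2)⟩

/-- Commutation with a fixed bounded operator survives strong limits, and `C` is its own
bicommutant. -/
lemma mem_of_tendsto_apply (C : VonNeumannAlgebra H) {c : ℕ → H →L[ℂ] H} {b : H →L[ℂ] H}
    (hc : ∀ n, c n ∈ C) (hb : ∀ x, Tendsto (fun n => c n x) atTop (𝓝 (b x))) : b ∈ C := by
  rw [← C.commutant_commutant, VonNeumannAlgebra.mem_commutant_iff]
  intro y hy
  ext x
  have h1 : Tendsto (fun n => y (c n x)) atTop (𝓝 (y (b x))) :=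
    (y.continuous.tendsto _).comp (hb x)
  refine tendsto_nhds_unique h1 ((hb (y x)).congr fun n => ?_)
  exact congr($(VonNeumannAlgebra.mem_commutant_iff.1 hy (c n) (hc n)) x)

lemma inclusion_nonneg {M C : VonNeumannAlgebra H} (hCM : C.toStarSubalgebra ≤ M.toStarSubalgebra)
    {c : C.toStarSubalgebra} (hc : 0 ≤ c) : 0 ≤ StarSubalgebra.inclusion hCM c := hc

/-- The infimum `0` of a decreasing sequence in a von Neumann subalgebra is its infimum in the
larger algebra as well. -/
lemma isGLB_range_inclusion {M C : VonNeumannAlgebra H}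
    (hCM : C.toStarSubalgebra ≤ M.toStarSubalgebra) {c : ℕ → C.toStarSubalgebra}
    (hc : Antitone c) (h0 : IsGLB (Set.range c) 0) :
    IsGLB (Set.range fun n => StarSubalgebra.inclusion hCM (c n)) 0 := by
  have hnn : ∀ n, 0 ≤ c n := fun n => h0.1 ⟨n, rfl⟩
  have hanti : Antitone fun n => (c n : H →L[ℂ] H) := fun m n h => hc h
  obtain ⟨b, hb⟩ := exists_tendsto_apply_of_antitone hanti hnn
  have hbC : b ∈ C := mem_of_tendsto_apply C (fun n => (c n).2) hb
  have hb0 : 0 ≤ b := nonneg_of_tendsto_apply (Eventually.of_forall hnn) hb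
  have hble : ∀ n, b ≤ c n := by
    intro n
    rw [← sub_nonneg]
    refine nonneg_of_tendsto_apply (c := fun m => c n - c m)
      ((eventually_ge_atTop n).mono fun m hm => sub_nonneg.2 (hanti hm)) fun x => ?_
    exact tendsto_const_nhds.sub (hb x)
  have hbl : (⟨b, hbC⟩ : C.toStarSubalgebra) ∈ lowerBounds (Set.range c) := by
    rintro _ ⟨n, rfl⟩
    exact hble n
  have hbz : b ≤ 0 := h0.2 hbl
  refine ⟨?_, ?_⟩
  · rintro _ ⟨n, rfl⟩
    exact hnn n
  -- Here `y` lies only in `M`, so the infimum in `C` says nothing about it directly. It lies below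
  -- the strong limit `b`, which belongs to `C` and is therefore at most `0`.
  · intro y hy
    have hyb : (0 : H →L[ℂ] H) ≤ b - (y : H →L[ℂ] H) := by
      refine nonneg_of_tendsto_apply (c := fun m => (c m : H →L[ℂ] H) - (y : H →L[ℂ] H))
        (Eventually.of_forall fun m => sub_nonneg.2 (show (y : H →L[ℂ] H) ≤ c m from hy ⟨m, rfl⟩))
        fun x => ?_
      exact (hb x).sub tendsto_const_nhds
    exact (sub_nonneg.1 hyb).trans hbz

/-- A positive element of a von Neumann algebra is a square there. -/
lemma exists_star_mul_self_of_nonneg {C : VonNeumannAlgebra H} {c : C.toStarSubalgebra}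
    (hc : 0 ≤ c) : ∃ s : C.toStarSubalgebra, c = star s * s := by
  have hc' : (0 : H →L[ℂ] H) ≤ c := hc
  have hmem : CFC.sqrt (c : H →L[ℂ] H) ∈ C := by
    -- The square root commutes with whatever commutes with `c`, so it lies in the bicommutant.
    refine C.commutant_commutant.le (VonNeumannAlgebra.mem_commutant_iff.2 fun y hy => ?_)
    have hcomm : Commute (c : H →L[ℂ] H) y :=
      VonNeumannAlgebra.mem_commutant_iff.1 hy _ c.2
    exact (hcomm.cfcₙ_nnreal _).eq.symm
  refine ⟨⟨_, hmem⟩, Subtype.ext ?_⟩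
  change (c : H →L[ℂ] H) = star (CFC.sqrt (c : H →L[ℂ] H)) * CFC.sqrt (c : H →L[ℂ] H)
  rw [(CFC.sqrt_nonneg (c : H →L[ℂ] H)).isSelfAdjoint.star_eq, CFC.sqrt_mul_sqrt_self _ hc']

lemma star_mul_self_nonneg_subalgebra {C : VonNeumannAlgebra H} (s : C.toStarSubalgebra) :
    0 ≤ star s * s :=
  show (0 : H →L[ℂ] H) ≤ star (s : H →L[ℂ] H) * (s : H →L[ℂ] H) from star_mul_self_nonneg _

end Operators

/-! ### From families of measures up to null sets to kernels -/

section Families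

open Filter Topology Set

variable {X Y : Type*} [MeasurableSpace X] [MeasurableSpace Y]

/-- A family of functions indexed by measurable sets which, outside null sets depending on the sets
in question, is nonnegative, additive and continuous at the empty set. -/
structure IsAEMeasureFamily (μ : Measure X) (m : Set Y → X → ℝ) : Prop where
  measurable : ∀ s, MeasurableSet s → Measurable (m s)
  nonneg : ∀ s, MeasurableSet s → ∀ᵐ x ∂μ, 0 ≤ m s x
  union : ∀ s t, MeasurableSet s → MeasurableSet t → Disjoint s t →
    ∀ᵐ x ∂μ, m (s ∪ t) x = m s x + m t x
  tendsto : ∀ s : ℕ → Set Y, (∀ n, MeasurableSet (s n)) → Antitone s → ⋂ n, s n = ∅ →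
    ∀ᵐ x ∂μ, Tendsto (fun n => m (s n) x) atTop (𝓝 0)

namespace IsAEMeasureFamily

variable {μ : Measure X} {m m' : Set Y → X → ℝ}

lemma empty (hm : IsAEMeasureFamily μ m) : ∀ᵐ x ∂μ, m ∅ x = 0 := by
  filter_upwards [hm.union ∅ ∅ .empty .empty disjoint_bot_left] with x hx
  simpa using hx

lemma diff (hm : IsAEMeasureFamily μ m) {s t : Set Y} (hs : MeasurableSet s) (ht : MeasurableSet t)
    (hst : s ⊆ t) : ∀ᵐ x ∂μ, m t x = m s x + m (t \ s) x := by
  have h := hm.union s (t \ s) hs (ht.diff hs) disjoint_sdiff_right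
  rwa [union_sdiff_cancel hst] at h

lemma mono (hm : IsAEMeasureFamily μ m) {s t : Set Y} (hs : MeasurableSet s) (ht : MeasurableSet t)
    (hst : s ⊆ t) : ∀ᵐ x ∂μ, m s x ≤ m t x := by
  filter_upwards [hm.diff hs ht hst, hm.nonneg _ (ht.diff hs)] with x h1 h2
  linarith

lemma tendsto_iInter (hm : IsAEMeasureFamily μ m) {s : ℕ → Set Y} (hs : ∀ n, MeasurableSet (s n))
    (hanti : Antitone s) :
    ∀ᵐ x ∂μ, Tendsto (fun n => m (s n) x) atTop (𝓝 (m (⋂ n, s n) x)) := by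
  have hI : MeasurableSet (⋂ n, s n) := .iInter hs
  have h0 := hm.tendsto (fun n => s n \ ⋂ k, s k) (fun n => (hs n).diff hI)
    (fun a b hab => sdiff_subset_sdiff_left (hanti hab)) (by
      refine eq_empty_of_forall_notMem fun y hy => ?_
      rw [mem_iInter] at hy
      exact (hy 0).2 (mem_iInter.2 fun n => (hy n).1))
  have h1 : ∀ᵐ x ∂μ, ∀ n, m (s n) x = m (⋂ n, s n) x + m (s n \ ⋂ k, s k) x :=
    ae_all_iff.2 fun n => hm.diff hI (hs n) (iInter_subset _ n)
  filter_upwards [h0, h1] with x h0 h1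
  simpa [h1] using h0.const_add (m (⋂ n, s n) x)

/-- The tails `r k = ⋃ i ≥ k, s i` decrease to the empty set, and the partial sums are `m (r 0) - m
(r n)`. Only countably many exceptional null sets enter. -/
lemma hasSum_iUnion (hm : IsAEMeasureFamily μ m) {s : ℕ → Set Y} (hs : ∀ n, MeasurableSet (s n))
    (hd : Pairwise (Function.onFun Disjoint s)) :
    ∀ᵐ x ∂μ, Tendsto (fun n => ∑ i ∈ Finset.range n, m (s i) x) atTop (𝓝 (m (⋃ n, s n) x)) := by
  let r : ℕ → Set Y := fun k => ⋃ i, ⋃ (_ : k ≤ i), s i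
  have hr : ∀ k, MeasurableSet (r k) := fun k => .iUnion fun i => .iUnion fun _ => hs i
  have hsucc : ∀ k, r k = s k ∪ r (k + 1) := by
    intro k
    ext y
    simp only [r, mem_iUnion, mem_union, exists_prop]
    constructor
    · rintro ⟨i, hi, hy⟩
      rcases hi.eq_or_lt with rfl | hi
      exacts [.inl hy, .inr ⟨i, hi, hy⟩]
    · rintro (hy | ⟨i, hi, hy⟩)
      exacts [⟨k, le_rfl, hy⟩, ⟨i, by omega, hy⟩]
  have hdisj : ∀ k, Disjoint (s k) (r (k + 1)) := by
    intro k
    simp only [r, disjoint_iUnion_right]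
    exact fun i hi => hd (by omega)
  have h1 : ∀ᵐ x ∂μ, ∀ k, m (r k) x = m (s k) x + m (r (k + 1)) x := by
    refine ae_all_iff.2 fun k => ?_
    have := hm.union _ _ (hs k) (hr (k + 1)) (hdisj k)
    rwa [← hsucc k] at this
  have h2 := hm.tendsto r hr (fun a b hab => by
    refine iUnion_mono fun i => ?_
    exact iUnion_subset fun hi => subset_iUnion_of_subset (hab.trans hi) subset_rfl) (by
      ext y
      simp only [r, mem_iInter, mem_iUnion, exists_prop, mem_empty_iff_false, iff_false, not_forall]
      by_cases hy : ∃ i, y ∈ s i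
      · obtain ⟨i, hi⟩ := hy
        refine ⟨i + 1, ?_⟩
        rintro ⟨j, hj, hyj⟩
        exact (hd (show i ≠ j by omega)).notMem_of_mem_left hi hyj
      · exact ⟨0, fun ⟨i, _, hi⟩ => hy ⟨i, hi⟩⟩)
  have hr0 : r 0 = ⋃ n, s n := by simp [r]
  filter_upwards [h1, h2] with x h1 h2
  have h3 : ∀ n, ∑ i ∈ Finset.range n, m (s i) x = m (⋃ n, s n) x - m (r n) x := by
    intro n
    induction n with
    | zero => simp [hr0]
    | succ n ih => rw [Finset.sum_range_succ, ih, h1 n]; ring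
  simpa [h3] using h2.const_sub (m (⋃ n, s n) x)

/-- Two families with the same total mass which agree on a generating `π`-system agree. -/
lemma ae_eq_of_generateFrom (hm : IsAEMeasureFamily μ m) (hm' : IsAEMeasureFamily μ m')
    {S : Set (Set Y)} (hgen : ‹MeasurableSpace Y› = MeasurableSpace.generateFrom S)
    (hpi : IsPiSystem S) (huniv : m univ =ᵐ[μ] m' univ) (hS : ∀ s ∈ S, m s =ᵐ[μ] m' s)
    {s : Set Y} (hs : MeasurableSet s) : m s =ᵐ[μ] m' s := by
  induction s, hs using MeasurableSpace.induction_on_inter hgen hpi with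
  | empty => filter_upwards [hm.empty, hm'.empty] with x h1 h2 using h1.trans h2.symm
  | basic t ht => exact hS t ht
  | compl t ht ih =>
    filter_upwards [hm.diff ht .univ (subset_univ t), hm'.diff ht .univ (subset_univ t), huniv, ih]
      with x h1 h2 h3 h4
    rw [compl_eq_univ_sdiff]
    linarith
  | iUnion f hd hf ih =>
    filter_upwards [hm.hasSum_iUnion hf hd, hm'.hasSum_iUnion hf hd, ae_all_iff.2 ih]
      with x h1 h2 h3
    simp only [h3] at h1
    exact tendsto_nhds_unique h1 h2

end IsAEMeasureFamily

lemma isAEMeasureFamily_kernel (μ : Measure X) (L : Kernel X Y) [IsFiniteKernel L] :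
    IsAEMeasureFamily μ fun s x => (L x).real s where
  measurable s hs := (L.measurable_coe hs).ennreal_toReal
  nonneg s hs := .of_forall fun x => measureReal_nonneg
  union s t hs ht hd := .of_forall fun x => measureReal_union hd ht
  tendsto s hs hanti hI := .of_forall fun x => by
    have h := tendsto_measure_iInter_atTop (μ := L x) (fun n => (hs n).nullMeasurableSet) hanti
      ⟨0, measure_ne_top _ _⟩
    rw [hI, measure_empty] at h
    exact (ENNReal.tendsto_toReal ENNReal.zero_ne_top).comp h

/-- A family of probability measures on the line defined up to null sets is given by a kernel. -/
lemma IsAEMeasureFamily.exists_markov_real {μ : Measure X} {m : Set ℝ → X → ℝ}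
    (hm : IsAEMeasureFamily μ m) (huniv : ∀ᵐ x ∂μ, m univ x = 1) :
    ∃ L : Kernel X ℝ, IsMarkovKernel L ∧
      ∀ s, MeasurableSet s → m s =ᵐ[μ] fun x => (L x).real s := by
  -- Rational arguments make monotonicity, limits and right continuity countably many conditions, so
  -- one null set suffices for all.
  let F : X → ℚ → ℝ := fun x q => m (Iic (q : ℝ)) x
  have hF : Measurable F := measurable_pi_lambda _ fun q => hm.measurable _ measurableSet_Iic
  have hmono : ∀ᵐ x ∂μ, Monotone (F x) := by
    have : ∀ᵐ x ∂μ, ∀ q r : ℚ, q ≤ r → F x q ≤ F x r := by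
      refine ae_all_iff.2 fun q => ae_all_iff.2 fun r => ?_
      by_cases hqr : q ≤ r
      · filter_upwards [hm.mono measurableSet_Iic measurableSet_Iic
          (Iic_subset_Iic.2 (Rat.cast_le (K := ℝ).2 hqr))] with x hx _ using hx
      · exact .of_forall fun x h => absurd h hqr
    filter_upwards [this] with x hx q r hqr using hx q r hqr
  have hbot : ∀ᵐ x ∂μ, Tendsto (fun n : ℕ => F x (-n)) atTop (𝓝 0) := by
    have := hm.tendsto (fun n : ℕ => Iic (((-n : ℚ)) : ℝ)) (fun n => measurableSet_Iic)
      (fun a b hab => Iic_subset_Iic.2 (by push_cast; simpa using hab)) (by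
        ext y
        simp only [mem_iInter, mem_Iic, mem_empty_iff_false, iff_false, not_forall, not_le]
        obtain ⟨n, hn⟩ := exists_nat_gt (-y)
        exact ⟨n, by push_cast; linarith⟩)
    exact this
  have htop : ∀ᵐ x ∂μ, Tendsto (fun n : ℕ => F x n) atTop (𝓝 1) := by
    have h1 := hm.tendsto (fun n : ℕ => univ \ Iic (((n : ℚ)) : ℝ))
      (fun n => MeasurableSet.univ.diff measurableSet_Iic)
      (fun a b hab => sdiff_subset_sdiff_right (Iic_subset_Iic.2 (by push_cast; simpa using hab))) (by
        ext y
        simp only [mem_iInter, Set.mem_sdiff, mem_univ, true_and, mem_Iic, mem_empty_iff_false,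
          iff_false, not_forall, not_not]
        obtain ⟨n, hn⟩ := exists_nat_gt y
        exact ⟨n, by push_cast; linarith⟩)
    have h2 : ∀ᵐ x ∂μ, ∀ n : ℕ, m univ x = F x n + m (univ \ Iic (((n : ℚ)) : ℝ)) x :=
      ae_all_iff.2 fun n => hm.diff measurableSet_Iic .univ (subset_univ _)
    filter_upwards [h1, h2, huniv] with x h1 h2 h3
    have h4 : (fun n : ℕ => F x n) = fun n : ℕ => 1 - m (univ \ Iic (((n : ℚ)) : ℝ)) x := by
      funext n
      linarith [h2 n]
    rw [h4]
    simpa using h1.const_sub 1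
  have hright : ∀ᵐ x ∂μ, ∀ t : ℚ,
      Tendsto (fun n : ℕ => F x (t + 1 / (n + 1))) atTop (𝓝 (F x t)) := by
    refine ae_all_iff.2 fun t => ?_
    have h := hm.tendsto_iInter (s := fun n : ℕ => Iic (((t + 1 / (n + 1) : ℚ)) : ℝ))
      (fun n => measurableSet_Iic) (fun a b hab => Iic_subset_Iic.2 (by
        refine Rat.cast_le.2 ?_
        have : (a : ℚ) ≤ b := by exact_mod_cast hab
        gcongr))
    have hI : ⋂ n : ℕ, Iic (((t + 1 / (n + 1) : ℚ)) : ℝ) = Iic (t : ℝ) := by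
      ext y
      simp only [mem_iInter, mem_Iic]
      constructor
      · intro hy
        have h1 : Tendsto (fun n : ℕ => (t : ℝ) + 1 / ((n : ℝ) + 1)) atTop (𝓝 ((t : ℝ) + 0)) :=
          tendsto_one_div_add_atTop_nhds_zero_nat.const_add _
        rw [add_zero] at h1
        exact ge_of_tendsto' h1 fun n => by simpa using hy n
      · intro hy n
        refine hy.trans (Rat.cast_le.2 ?_)
        have : (0 : ℚ) ≤ 1 / (n + 1) := by positivity
        linarith
    rwa [hI] at h
  have hgood : ∀ᵐ x ∂μ, IsRatStieltjesPoint F x := by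
    filter_upwards [hmono, hbot, htop, hright] with x hmono hbot htop hright
    have hb : Tendsto (F x) atBot (𝓝 0) := by
      have h1 : Antitone fun q : ℚ => F x (-q) := fun a b hab => hmono (neg_le_neg hab)
      have h2 := (tendsto_iff_tendsto_subseq_of_antitone h1
        (tendsto_natCast_atTop_atTop (R := ℚ)) (l := 0)).2 hbot
      simpa [Function.comp_def] using h2.comp tendsto_neg_atBot_atTop
    refine ⟨hmono, ?_, hb, fun t => ?_⟩
    · exact (tendsto_iff_tendsto_subseq_of_monotone hmono
        (tendsto_natCast_atTop_atTop (R := ℚ))).2 htop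
    · have : Nonempty (Ioi t) := ⟨⟨t + 1, by simp⟩⟩
      refine le_antisymm ?_ (le_ciInf fun r => hmono r.2.le)
      refine ge_of_tendsto' (hright t) fun n => ?_
      exact ciInf_le (f := fun r : Ioi t => F x r)
        ⟨F x t, by rintro _ ⟨r, rfl⟩; exact hmono r.2.le⟩
        ⟨t + 1 / (n + 1), by simp only [mem_Ioi, lt_add_iff_pos_right]; positivity⟩
  -- At bad points `stieltjesOfMeasurableRat` substitutes a default distribution function, so `L x`
  -- is a probability measure for every `x`.
  let L : Kernel X ℝ :=
    ⟨fun x => (stieltjesOfMeasurableRat F hF x).measure,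
      measurable_measure_stieltjesOfMeasurableRat hF⟩
  have hL : IsMarkovKernel L := ⟨fun x => ⟨measure_stieltjesOfMeasurableRat_univ hF x⟩⟩
  refine ⟨L, hL, fun s hs => hm.ae_eq_of_generateFrom (isAEMeasureFamily_kernel μ L)
    (Real.borelSpace.measurable_eq.trans Real.borel_eq_generateFrom_Iic_rat)
    Real.isPiSystem_Iic_rat ?_ ?_ hs⟩
  · filter_upwards [huniv] with x hx
    simp [hx]
  · intro t ht
    obtain ⟨q, rfl⟩ : ∃ q : ℚ, Iic (q : ℝ) = t := by simpa using ht
    filter_upwards [hgood] with x hx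
    have h1 : L x (Iic (q : ℝ)) = ENNReal.ofReal (F x q) := by
      change (stieltjesOfMeasurableRat F hF x).measure (Iic (q : ℝ)) = _
      rw [measure_stieltjesOfMeasurableRat_Iic, stieltjesOfMeasurableRat_eq,
        toRatCDF_of_isRatStieltjesPoint hx]
    rw [measureReal_def, h1, ENNReal.toReal_ofReal]
    exact Monotone.le_of_tendsto hx.mono hx.tendsto_atBot_zero q

/-- A family of measures of mass at most one on a standard Borel space, defined up to null sets, is
given by a sub-Markov kernel. -/
lemma IsAEMeasureFamily.exists_subMarkov [StandardBorelSpace X] {μ : Measure X}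
    {m : Set X → X → ℝ} (hm : IsAEMeasureFamily μ m) (huniv : ∀ᵐ x ∂μ, m univ x ≤ 1) :
    ∃ K : Kernel X X, IsSubMarkov K ∧ ∀ s, MeasurableSet s → m s =ᵐ[μ] fun x => (K x).real s := by
  classical
  obtain ⟨e, he⟩ := exists_measurableEmbedding_real X
  -- The exponential moves `X` into the positive reals, which frees `0` to serve as a cemetery
  -- point.
  have hg : MeasurableEmbedding fun x => Real.exp (e x) :=
    Real.continuous_exp.measurableEmbedding Real.exp_injective |>.comp he
  set g : X → ℝ := fun x => Real.exp (e x) with hgdef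
  have hg0 : ∀ x, g x ≠ 0 := fun x => Real.exp_ne_zero _
  -- The missing mass is placed at `0`, making the total mass one; `comapRight` along `g` discards
  -- it again below.
  let n : Set ℝ → X → ℝ := fun s x => m (g ⁻¹' s) x + s.indicator 1 (0 : ℝ) * (1 - m univ x)
  have hn : IsAEMeasureFamily μ n :=
    { measurable := fun s hs => (hm.measurable _ (hg.measurable hs)).add
        ((measurable_const.sub (hm.measurable _ .univ)).const_mul _)
      nonneg := fun s hs => by
        filter_upwards [hm.nonneg _ (hg.measurable hs), huniv] with x h1 h2
        refine add_nonneg h1 (mul_nonneg ?_ (sub_nonneg.2 h2))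
        exact indicator_nonneg (fun _ _ => zero_le_one) _
      union := fun s t hs ht hd => by
        filter_upwards [hm.union _ _ (hg.measurable hs) (hg.measurable ht) (hd.preimage g)]
          with x hx
        simp only [n, preimage_union, hx, indicator_union_of_disjoint hd]
        ring
      tendsto := fun s hs hanti hI => by
        filter_upwards [hm.tendsto (fun k => g ⁻¹' s k) (fun k => hg.measurable (hs k))
          (fun a b hab => preimage_mono (hanti hab)) (by rw [← preimage_iInter, hI, preimage_empty])]
          with x hx
        obtain ⟨k, hk⟩ : ∃ k, (0 : ℝ) ∉ s k := by
          by_contra! h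
          exact (hI ▸ mem_iInter.2 h : (0 : ℝ) ∈ (∅ : Set ℝ))
        refine hx.congr' ((eventually_ge_atTop k).mono fun j hj => ?_)
        simp [n, indicator_of_notMem fun h => hk (hanti hj h)] }
  obtain ⟨L, hL, hLn⟩ := hn.exists_markov_real (.of_forall fun x => by simp [n])
  refine ⟨L.comapRight hg, fun x => ?_, fun s hs => ?_⟩
  · rw [Kernel.comapRight_apply' _ _ _ .univ]
    exact prob_le_one
  · filter_upwards [hLn _ (hg.measurableSet_image.2 hs)] with x hx
    rw [measureReal_def, Kernel.comapRight_apply' _ _ _ hs, ← measureReal_def, ← hx]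
    have h0 : (0 : ℝ) ∉ g '' s := by rintro ⟨y, _, hy⟩; exact hg0 y hy
    simp [n, preimage_image_eq s hg.injective, indicator_of_notMem h0]

end Families

/-! ### Order and limits through the identification with `L^∞` -/

section Representatives

open Filter Topology
open scoped ComplexOrder

namespace LinftyIdentification

variable {X : Type*} [MeasurableSpace X] {μ : Measure X}

section Algebra

variable {C : Type*} [Ring C] [Algebra ℂ C] [Star C] (Φ : LinftyIdentification C μ)

lemma measurable_rep (c : C) : Measurable (Φ.rep c) :=
  (Lp.stronglyMeasurable _).measurable

lemma rep_zero : Φ.rep 0 =ᵐ[μ] 0 := by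
  rw [rep, map_zero]
  exact Lp.coeFn_zero _ _ _

lemma rep_add (a b : C) : Φ.rep (a + b) =ᵐ[μ] fun x => Φ.rep a x + Φ.rep b x := by
  rw [rep, map_add]
  exact Lp.coeFn_add _ _

lemma rep_sub (a b : C) : Φ.rep (a - b) =ᵐ[μ] fun x => Φ.rep a x - Φ.rep b x := by
  rw [rep, map_sub]
  exact Lp.coeFn_sub _ _

lemma rep_smul (z : ℂ) (a : C) : Φ.rep (z • a) =ᵐ[μ] fun x => z * Φ.rep a x := by
  rw [rep, map_smul]
  exact Lp.coeFn_smul _ _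

lemma rep_mul (a b : C) : Φ.rep (a * b) =ᵐ[μ] fun x => Φ.rep a x * Φ.rep b x :=
  Φ.map_mul a b

lemma rep_star (a : C) : Φ.rep (star a) =ᵐ[μ] fun x => star (Φ.rep a x) :=
  Φ.map_star a

lemma eq_of_rep_ae_eq {a b : C} (h : Φ.rep a =ᵐ[μ] Φ.rep b) : a = b :=
  Φ.toLinearEquiv.injective (Lp.ext h)

lemma exists_rep_ae_eq {f : X → ℂ} (hf : Measurable f) {b : ℝ} (hb : ∀ x, ‖f x‖ ≤ b) :
    ∃ c : C, Φ.rep c =ᵐ[μ] f := by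
  have h : MemLp f ∞ μ := memLp_top_of_bound hf.aestronglyMeasurable b (.of_forall hb)
  refine ⟨Φ.toLinearEquiv.symm (h.toLp f), ?_⟩
  rw [rep, LinearEquiv.apply_symm_apply]
  exact h.coeFn_toLp

lemma exists_norm_rep_le (c : C) : ∃ b : ℝ, 0 ≤ b ∧ ∀ᵐ x ∂μ, ‖Φ.rep c x‖ ≤ b :=
  ⟨‖Φ.toLinearEquiv c‖, norm_nonneg _, by
    filter_upwards [ae_le_eLpNormEssSup (f := Φ.rep c) (μ := μ)] with x hx
    rw [← eLpNorm_exponent_top] at hx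
    have h2 := ENNReal.toReal_mono (Lp.eLpNorm_ne_top (Φ.toLinearEquiv c)) hx
    rw [Lp.norm_def, ← toReal_enorm]
    exact h2⟩

/-- Unitality follows from multiplicativity and surjectivity: multiply the element represented by
the constant `1` by the unit. -/
lemma rep_one : Φ.rep 1 =ᵐ[μ] 1 := by
  obtain ⟨e, he⟩ := Φ.exists_rep_ae_eq (f := 1) measurable_const (b := 1) (by simp)
  have h := Φ.rep_mul e 1
  rw [mul_one] at h
  filter_upwards [h, he] with x h1 h2
  simp_all

end Algebra

section Order

variable {H : Type*} [NormedAddCommGroup H] [InnerProductSpace ℂ H] [CompleteSpace H]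
  {C : VonNeumannAlgebra H} (Φ : LinftyIdentification C.toStarSubalgebra μ)

/-- On both sides the positive elements are exactly the `star s * s`, and this form is preserved by
a `*`-isomorphism. -/
lemma nonneg_iff {c : C.toStarSubalgebra} : 0 ≤ c ↔ ∀ᵐ x ∂μ, 0 ≤ Φ.rep c x := by
  constructor
  · intro hc
    obtain ⟨s, rfl⟩ := exists_star_mul_self_of_nonneg hc
    filter_upwards [Φ.rep_mul (star s) s, Φ.rep_star s] with x h1 h2
    rw [h1, h2]
    exact star_mul_self_nonneg _
  · intro hc
    obtain ⟨b, hb0, hb⟩ := Φ.exists_norm_rep_le c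
    obtain ⟨s, hs⟩ := Φ.exists_rep_ae_eq
      (f := fun x => ((√(min (Φ.rep c x).re b) : ℝ) : ℂ))
      (Complex.measurable_ofReal.comp
        ((Complex.measurable_re.comp (Φ.measurable_rep c)).min measurable_const).sqrt)
      (b := √b) (fun x => by
        rw [Complex.norm_real, Real.norm_of_nonneg (Real.sqrt_nonneg _)]
        exact Real.sqrt_le_sqrt (min_le_right _ _))
    have : c = star s * s := by
      refine Φ.eq_of_rep_ae_eq ?_
      filter_upwards [Φ.rep_mul (star s) s, Φ.rep_star s, hs, hc, hb] with x h1 h2 h3 h4 h5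
      have h6 : 0 ≤ (Φ.rep c x).re := (Complex.le_def.1 h4).1
      have h7 : (Φ.rep c x).re ≤ b := (Complex.re_le_norm _).trans h5
      rw [h1, h2, h3, min_eq_left h7]
      simp only [RCLike.star_def, Complex.conj_ofReal]
      rw [← Complex.ofReal_mul, Real.mul_self_sqrt h6]
      exact Complex.eq_re_of_ofReal_le h4
    rw [this]
    exact star_mul_self_nonneg_subalgebra s

lemma le_iff {a b : C.toStarSubalgebra} : a ≤ b ↔ ∀ᵐ x ∂μ, Φ.rep a x ≤ Φ.rep b x := by
  have h0 : a ≤ b ↔ 0 ≤ b - a :=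
    (sub_nonneg (a := (b : H →L[ℂ] H)) (b := (a : H →L[ℂ] H))).symm
  rw [h0, Φ.nonneg_iff]
  refine eventually_congr ?_
  filter_upwards [Φ.rep_sub b a] with x hx
  rw [hx, sub_nonneg]

/-- Truncation turns almost everywhere bounds into the everywhere bounds that `IsImplementedBy`
demands. -/
lemma exists_bounded_rep {c : C.toStarSubalgebra} (hc : 0 ≤ c) :
    ∃ f : X → ℝ, Measurable f ∧ (∀ x, 0 ≤ f x) ∧ (∃ b, ∀ x, f x ≤ b) ∧
      Φ.rep c =ᵐ[μ] fun x => (f x : ℂ) := by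
  obtain ⟨b, hb0, hb⟩ := Φ.exists_norm_rep_le c
  refine ⟨fun x => max 0 (min (Φ.rep c x).re b), ?_, fun x => le_max_left _ _,
    ⟨b, fun x => max_le hb0 (min_le_right _ _)⟩, ?_⟩
  · exact measurable_const.max
      ((Complex.measurable_re.comp (Φ.measurable_rep c)).min measurable_const)
  · filter_upwards [hb, Φ.nonneg_iff.1 hc] with x h5 h4
    have h6 : 0 ≤ (Φ.rep c x).re := (Complex.le_def.1 h4).1
    have h7 : (Φ.rep c x).re ≤ b := (Complex.re_le_norm _).trans h5
    rw [min_eq_left h7, max_eq_right h6]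
    exact Complex.eq_re_of_ofReal_le h4

/-- A decreasing sequence which tends to `0` almost everywhere has infimum `0`. -/
lemma isGLB_range_of_tendsto {c : ℕ → C.toStarSubalgebra} (hc : ∀ n, 0 ≤ c n)
    (h : ∀ᵐ x ∂μ, Tendsto (fun n => (Φ.rep (c n) x).re) atTop (𝓝 0)) :
    IsGLB (Set.range c) 0 := by
  refine ⟨?_, fun b hb => ?_⟩
  · rintro _ ⟨n, rfl⟩
    exact hc n
  · rw [Φ.le_iff]
    have h1 : ∀ᵐ x ∂μ, ∀ n, Φ.rep b x ≤ Φ.rep (c n) x :=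
      ae_all_iff.2 fun n => Φ.le_iff.1 (hb ⟨n, rfl⟩)
    have h2 : ∀ᵐ x ∂μ, ∀ n, 0 ≤ Φ.rep (c n) x := ae_all_iff.2 fun n => Φ.nonneg_iff.1 (hc n)
    filter_upwards [h, h1, h2, Φ.rep_zero] with x h h1 h2 h3
    rw [h3, Pi.zero_apply, Complex.le_def]
    refine ⟨ge_of_tendsto' h fun n => (Complex.le_def.1 (h1 n)).1, ?_⟩
    rw [(Complex.le_def.1 (h1 0)).2, ← (Complex.le_def.1 (h2 0)).2]

/-- A decreasing sequence with infimum `0` tends to `0` almost everywhere. -/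
lemma tendsto_of_isGLB_range {c : ℕ → C.toStarSubalgebra} (hc : Antitone c)
    (h : IsGLB (Set.range c) 0) :
    ∀ᵐ x ∂μ, Tendsto (fun n => (Φ.rep (c n) x).re) atTop (𝓝 0) := by
  have hnn : ∀ n, 0 ≤ c n := fun n => h.1 ⟨n, rfl⟩
  have h0 : ∀ᵐ x ∂μ, ∀ n, 0 ≤ Φ.rep (c n) x := ae_all_iff.2 fun n => Φ.nonneg_iff.1 (hnn n)
  have h1 : ∀ᵐ x ∂μ, ∀ n, Φ.rep (c (n + 1)) x ≤ Φ.rep (c n) x :=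
    ae_all_iff.2 fun n => Φ.le_iff.1 (hc n.le_succ)
  obtain ⟨b, hb0, hb⟩ := Φ.exists_norm_rep_le (c 0)
  -- The truncated pointwise infimum is bounded, so it represents some `e` in `C`. This `e` is a
  -- lower bound of the sequence, hence `e ≤ 0` and `g = 0` almost everywhere.
  let g : X → ℝ := fun x => max 0 (min (⨅ n, (Φ.rep (c n) x).re) b)
  have hg : Measurable g := measurable_const.max
    ((Measurable.iInf fun n => Complex.measurable_re.comp (Φ.measurable_rep (c n))).min
      measurable_const)
  obtain ⟨e, he⟩ := Φ.exists_rep_ae_eq (f := fun x => (g x : ℂ))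
    (Complex.measurable_ofReal.comp hg) (b := b) (fun x => by
      rw [Complex.norm_real, Real.norm_of_nonneg (le_max_left _ _)]
      exact max_le hb0 (min_le_right _ _))
  have hlim : ∀ᵐ x ∂μ, Tendsto (fun n => (Φ.rep (c n) x).re) atTop (𝓝 (g x)) ∧
      ∀ n, g x ≤ (Φ.rep (c n) x).re := by
    filter_upwards [h0, h1, hb] with x h0 h1 hb
    have hanti : Antitone fun n => (Φ.rep (c n) x).re :=
      antitone_nat_of_succ_le fun n => (Complex.le_def.1 (h1 n)).1
    have hbdd : BddBelow (Set.range fun n => (Φ.rep (c n) x).re) :=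
      ⟨0, by rintro _ ⟨n, rfl⟩; exact (Complex.le_def.1 (h0 n)).1⟩
    have hgx : g x = ⨅ n, (Φ.rep (c n) x).re := by
      have h2 : ⨅ n, (Φ.rep (c n) x).re ≤ b :=
        (ciInf_le hbdd 0).trans ((Complex.re_le_norm _).trans hb)
      have h3 : 0 ≤ ⨅ n, (Φ.rep (c n) x).re := le_ciInf fun n => (Complex.le_def.1 (h0 n)).1
      simp only [g, min_eq_left h2, max_eq_right h3]
    rw [hgx]
    exact ⟨tendsto_atTop_ciInf hanti hbdd, ciInf_le hbdd⟩
  have hle : e ≤ 0 := by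
    refine h.2 ?_
    rintro _ ⟨n, rfl⟩
    rw [Φ.le_iff]
    filter_upwards [he, hlim, h0] with x h2 h3 h4
    rw [h2, Complex.le_def]
    exact ⟨by simpa using h3.2 n, by simpa using (Complex.le_def.1 (h4 n)).2⟩
  filter_upwards [Φ.le_iff.1 hle, he, hlim, Φ.rep_zero] with x h2 h3 h4 h5
  have h6 : g x ≤ 0 := by
    rw [h3, h5] at h2
    simpa using (Complex.le_def.1 h2).1
  rw [show (0 : ℝ) = g x from le_antisymm (le_max_left _ _) h6]
  exact h4.1

end Order

end LinftyIdentification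

end Representatives

/-! ### Implementing normal maps by sub-Markov kernels -/

section Implementation

open Filter Topology
open scoped ComplexOrder

variable {X : Type*} [MeasurableSpace X] {μ : Measure X}

lemma IsSubMarkov.isFiniteKernel {K : Kernel X X} (hK : IsSubMarkov K) : IsFiniteKernel K :=
  ⟨1, ENNReal.one_lt_top, hK⟩

lemma IsSubMarkov.pow {K : Kernel X X} (hK : IsSubMarkov K) (n : ℕ) : IsSubMarkov (K ^ n) := by
  induction n with
  | zero =>
    intro x
    rw [pow_zero]
    change Kernel.id x Set.univ ≤ 1
    simp
  | succ n ih =>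
    intro x
    rw [pow_succ]
    change ((K ^ n) ∘ₖ K) x Set.univ ≤ 1
    rw [Kernel.comp_apply' _ _ _ .univ]
    calc ∫⁻ y, (K ^ n) y Set.univ ∂(K x) ≤ ∫⁻ _, 1 ∂(K x) := lintegral_mono ih
      _ ≤ 1 := by simpa using hK x

variable {H : Type*} [NormedAddCommGroup H] [InnerProductSpace ℂ H] [CompleteSpace H]
  {C : VonNeumannAlgebra H} (Φ : LinftyIdentification C.toStarSubalgebra μ)
  {P : C.toStarSubalgebra →ₗ[ℂ] C.toStarSubalgebra}

/-- Order continuity along decreasing sequences with infimum `0`. -/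
def IsSeqNormal (P : C.toStarSubalgebra →ₗ[ℂ] C.toStarSubalgebra) : Prop :=
  ∀ c : ℕ → C.toStarSubalgebra, Antitone c → IsGLB (Set.range c) 0 →
    IsGLB (Set.range fun n => P (c n)) 0

lemma map_mono_of_nonneg (hpos : ∀ c, 0 ≤ c → 0 ≤ P c) {a b : C.toStarSubalgebra} (hab : a ≤ b) :
    P a ≤ P b := by
  have h := hpos (b - a) (sub_nonneg.2 (show (a : H →L[ℂ] H) ≤ b from hab))
  rw [map_sub] at h
  exact sub_nonneg.1 (show (0 : H →L[ℂ] H) ≤ (P b : H →L[ℂ] H) - (P a : H →L[ℂ] H) from h)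

include Φ in
lemma tendsto_rep_map (hpos : ∀ c, 0 ≤ c → 0 ≤ P c) (hP : IsSeqNormal P)
    {c : ℕ → C.toStarSubalgebra} (hc : Antitone c) (hnn : ∀ n, 0 ≤ c n)
    (h : ∀ᵐ x ∂μ, Tendsto (fun n => (Φ.rep (c n) x).re) atTop (𝓝 0)) :
    ∀ᵐ x ∂μ, Tendsto (fun n => (Φ.rep (P (c n)) x).re) atTop (𝓝 0) :=
  Φ.tendsto_of_isGLB_range (fun _ _ hmn => map_mono_of_nonneg hpos (hc hmn))
    (hP c hc (Φ.isGLB_range_of_tendsto hnn h))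

lemma exists_rep_indicator {s : Set X} (hs : MeasurableSet s) :
    ∃ c, Φ.rep c =ᵐ[μ] fun x => ((s.indicator 1 x : ℝ) : ℂ) :=
  Φ.exists_rep_ae_eq (Complex.measurable_ofReal.comp (measurable_one.indicator hs)) (b := 1)
    fun x => by by_cases hx : x ∈ s <;> simp [hx]

/-- A positive sequentially normal map defines a family of measures up to null sets. -/
lemma exists_isAEMeasureFamily (hpos : ∀ c, 0 ≤ c → 0 ≤ P c) (hP : IsSeqNormal P) :
    ∃ m : Set X → X → ℝ, IsAEMeasureFamily μ m ∧ ∀ s, MeasurableSet s → ∀ c,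
      (Φ.rep c =ᵐ[μ] fun x => ((s.indicator 1 x : ℝ) : ℂ)) →
        Φ.rep (P c) =ᵐ[μ] fun x => (m s x : ℂ) := by
  have h : ∀ s : Set X, ∃ c, MeasurableSet s →
      Φ.rep c =ᵐ[μ] fun x => ((s.indicator 1 x : ℝ) : ℂ) := fun s => by
    by_cases hs : MeasurableSet s
    · exact (exists_rep_indicator Φ hs).imp fun c hc _ => hc
    · exact ⟨0, fun h => absurd h hs⟩
  choose e he using h
  have he0 : ∀ s, MeasurableSet s → 0 ≤ e s := fun s hs => by
    rw [Φ.nonneg_iff]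
    filter_upwards [he s hs] with x hx
    rw [hx]
    exact Complex.zero_le_real.2 (Set.indicator_nonneg (fun _ _ => zero_le_one) _)
  refine ⟨fun s x => (Φ.rep (P (e s)) x).re, ⟨?_, ?_, ?_, ?_⟩, ?_⟩
  · exact fun s hs => Complex.measurable_re.comp (Φ.measurable_rep _)
  · intro s hs
    filter_upwards [Φ.nonneg_iff.1 (hpos _ (he0 s hs))] with x hx
    exact (Complex.le_def.1 hx).1
  · intro s t hs ht hd
    have h1 : e (s ∪ t) = e s + e t := by
      refine Φ.eq_of_rep_ae_eq ?_
      filter_upwards [he s hs, he t ht, he _ (hs.union ht), Φ.rep_add (e s) (e t)]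
        with x h1 h2 h3 h4
      rw [h4, h1, h2, h3, Set.indicator_union_of_disjoint hd]
      push_cast
      rfl
    rw [h1, map_add]
    filter_upwards [Φ.rep_add (P (e s)) (P (e t))] with x hx
    rw [hx, Complex.add_re]
  · intro s hs hanti hI
    refine tendsto_rep_map Φ hpos hP (c := fun n => e (s n)) (fun a b hab => ?_)
      (fun n => he0 _ (hs n)) ?_
    · rw [Φ.le_iff]
      filter_upwards [he _ (hs a), he _ (hs b)] with x h1 h2
      rw [h1, h2]
      exact Complex.real_le_real.2
        (Set.indicator_le_indicator_of_subset (hanti hab) (fun _ => zero_le_one) x)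
    · filter_upwards [ae_all_iff.2 fun n => he _ (hs n)] with x hx
      obtain ⟨k, hk⟩ : ∃ k, x ∉ s k := by
        by_contra! h
        exact (hI ▸ Set.mem_iInter.2 h : x ∈ (∅ : Set X))
      refine tendsto_const_nhds.congr' ((eventually_ge_atTop k).mono fun j hj => ?_)
      simp [hx, Set.indicator_of_notMem fun h => hk (hanti hj h)]
  · intro s hs c hc
    rw [Φ.eq_of_rep_ae_eq (hc.trans (he s hs).symm)]
    filter_upwards [Φ.nonneg_iff.1 (hpos _ (he0 s hs))] with x hx
    exact Complex.eq_re_of_ofReal_le hx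

/-- A kernel which implements a positive sequentially normal map on indicators implements it. -/
lemma isImplementedBy_of_indicator (hpos : ∀ c, 0 ≤ c → 0 ≤ P c) (hP : IsSeqNormal P)
    {K : Kernel X X} (hK : IsSubMarkov K)
    (hind : ∀ s, MeasurableSet s → ∀ c,
      (Φ.rep c =ᵐ[μ] fun x => ((s.indicator 1 x : ℝ) : ℂ)) →
        Φ.rep (P c) =ᵐ[μ] fun x => (((K x).real s : ℝ) : ℂ)) :
    IsImplementedBy Φ P K := by
  have : IsFiniteKernel K := hK.isFiniteKernel
  have hexists : ∀ {f : X → ℝ≥0∞} {b : ℝ≥0∞}, Measurable f → b ≠ ∞ → (∀ x, f x ≤ b) →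
      ∃ c, Φ.rep c =ᵐ[μ] fun x => ((f x).toReal : ℂ) := fun {f b} hf hb hfb =>
    Φ.exists_rep_ae_eq (Complex.measurable_ofReal.comp hf.ennreal_toReal) (b := b.toReal)
      fun x => by
        simpa using ENNReal.toReal_mono hb (hfb x)
  have hfin : ∀ {f : X → ℝ≥0∞} {b : ℝ≥0∞}, b ≠ ∞ → (∀ x, f x ≤ b) → ∀ x,
      ∫⁻ y, f y ∂(K x) ≠ ∞ := fun {f b} hb hfb x =>
    ((lintegral_mono hfb).trans_lt (by
      rw [lintegral_const]; exact ENNReal.mul_lt_top hb.lt_top (measure_lt_top _ _))).ne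
  -- The bound stays inside the induction motive because summands and increasing approximants
  -- inherit it.
  have key : ∀ f : X → ℝ≥0∞, Measurable f → ∀ b : ℝ≥0∞, b ≠ ∞ → (∀ x, f x ≤ b) →
      ∀ c, (Φ.rep c =ᵐ[μ] fun x => ((f x).toReal : ℂ)) →
        Φ.rep (P c) =ᵐ[μ] fun x => ((∫⁻ y, f y ∂(K x)).toReal : ℂ) := by
    refine fun f hf => Measurable.ennreal_induction (motive := fun f => ∀ b : ℝ≥0∞, b ≠ ∞ →
      (∀ x, f x ≤ b) → ∀ c, (Φ.rep c =ᵐ[μ] fun x => ((f x).toReal : ℂ)) →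
        Φ.rep (P c) =ᵐ[μ] fun x => ((∫⁻ y, f y ∂(K x)).toReal : ℂ)) ?_ ?_ ?_ hf
    · intro a s hs b _ _ c hc
      obtain ⟨e, he⟩ := exists_rep_indicator Φ hs
      have h1 : c = (a.toReal : ℂ) • e := by
        refine Φ.eq_of_rep_ae_eq ?_
        filter_upwards [hc, he, Φ.rep_smul (a.toReal : ℂ) e] with x h1 h2 h3
        rw [h1, h3, h2]
        by_cases hx : x ∈ s <;> simp [hx]
      rw [h1, map_smul]
      filter_upwards [hind s hs e he, Φ.rep_smul (a.toReal : ℂ) (P e)] with x h2 h3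
      rw [h3, h2, lintegral_indicator_const hs, ENNReal.toReal_mul, measureReal_def]
      push_cast
      rfl
    · intro f g hd hf hg ihf ihg b hb hfb c hc
      have hfb1 : ∀ x, f x ≤ b := fun x => le_self_add.trans (hfb x)
      have hfb2 : ∀ x, g x ≤ b := fun x => le_add_self.trans (hfb x)
      obtain ⟨c1, hc1⟩ := hexists hf hb hfb1
      obtain ⟨c2, hc2⟩ := hexists hg hb hfb2
      have h1 : c = c1 + c2 := by
        refine Φ.eq_of_rep_ae_eq ?_
        filter_upwards [hc, hc1, hc2, Φ.rep_add c1 c2] with x h1 h2 h3 h4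
        rw [h1, h4, h2, h3, Pi.add_apply, ENNReal.toReal_add (ne_top_of_le_ne_top hb (hfb1 x))
          (ne_top_of_le_ne_top hb (hfb2 x))]
        push_cast
        rfl
      rw [h1, map_add]
      filter_upwards [ihf b hb hfb1 c1 hc1, ihg b hb hfb2 c2 hc2, Φ.rep_add (P c1) (P c2)]
        with x h1 h2 h3
      rw [h3, h1, h2]
      simp only [Pi.add_apply]
      rw [lintegral_add_left hf, ENNReal.toReal_add (hfin hb hfb1 x) (hfin hb hfb2 x)]
      push_cast
      rfl
    · intro f hf hmono ih b hb hfb c hc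
      have hfb1 : ∀ n x, f n x ≤ b := fun n x =>
        (le_iSup (fun n => f n x) n).trans (hfb x)
      have hex : ∀ n, ∃ e, Φ.rep e =ᵐ[μ] fun x => ((f n x).toReal : ℂ) :=
        fun n => hexists (hf n) hb (hfb1 n)
      choose e he using hex
      have hee : ∀ m n, m ≤ n → e m ≤ e n := fun m n hmn => by
        rw [Φ.le_iff]
        filter_upwards [he m, he n] with x h1 h2
        rw [h1, h2]
        exact Complex.real_le_real.2
          (ENNReal.toReal_mono (ne_top_of_le_ne_top hb (hfb1 n x)) (hmono hmn x))
      have hec : ∀ n, e n ≤ c := fun n => by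
        rw [Φ.le_iff]
        filter_upwards [he n, hc] with x h1 h2
        rw [h1, h2]
        refine Complex.real_le_real.2
          (ENNReal.toReal_mono (ne_top_of_le_ne_top hb (hfb x)) ?_)
        exact le_iSup (fun n => f n x) n
      have hc0 : 0 ≤ c := by
        rw [Φ.nonneg_iff]
        filter_upwards [hc] with x hx
        rw [hx]
        exact Complex.zero_le_real.2 ENNReal.toReal_nonneg
      -- Order continuity is available only for sequences decreasing to `0`, so it is applied to the
      -- differences `c - e n`.
      have hlim := tendsto_rep_map Φ hpos hP (c := fun n => c - e n)
        (fun m n hmn => sub_le_sub_left (show (e m : H →L[ℂ] H) ≤ e n from hee m n hmn) _)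
        (fun n => sub_nonneg.2 (show (e n : H →L[ℂ] H) ≤ c from hec n)) (by
          filter_upwards [ae_all_iff.2 he, hc, ae_all_iff.2 fun n => Φ.rep_sub c (e n)]
            with x h1 h2 h3
          have h4 : Tendsto (fun n => f n x) atTop (𝓝 (⨆ n, f n x)) :=
            tendsto_atTop_iSup fun m n hmn => hmono hmn x
          have h5 := (ENNReal.tendsto_toReal (ne_top_of_le_ne_top hb (hfb x))).comp h4
          have h6 := h5.const_sub (⨆ n, f n x).toReal
          rw [sub_self] at h6
          refine h6.congr fun n => ?_
          simp [h1, h2, h3])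
      filter_upwards [hlim, Φ.nonneg_iff.1 (hpos _ hc0),
        ae_all_iff.2 fun n => ih n b hb (hfb1 n) (e n) (he n),
        ae_all_iff.2 fun n => Φ.rep_sub (P c) (P (e n))] with x h1 h2 h3 h4
      have h5 : Tendsto (fun n => ∫⁻ y, f n y ∂(K x)) atTop (𝓝 (∫⁻ y, ⨆ n, f n y ∂(K x))) := by
        rw [lintegral_iSup hf hmono]
        exact tendsto_atTop_iSup fun m n hmn => lintegral_mono (hmono hmn)
      have h6 := (ENNReal.tendsto_toReal (hfin hb hfb x)).comp h5
      have h7 : Tendsto (fun n => (∫⁻ y, f n y ∂(K x)).toReal) atTop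
          (𝓝 (Φ.rep (P c) x).re) := by
        have h8 := h1.const_sub (Φ.rep (P c) x).re
        rw [sub_zero] at h8
        refine h8.congr fun n => ?_
        rw [map_sub, h4 n, Complex.sub_re, h3 n, Complex.ofReal_re]
        ring
      rw [tendsto_nhds_unique h6 h7]
      exact Complex.eq_re_of_ofReal_le h2
  intro f hf hf0 ⟨b, hb⟩ c hc
  have h := key (fun x => ENNReal.ofReal (f x)) hf.ennreal_ofReal (ENNReal.ofReal b)
    ENNReal.ofReal_ne_top (fun x => ENNReal.ofReal_le_ofReal (hb x)) c (by
      filter_upwards [hc] with x hx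
      rw [hx, ENNReal.toReal_ofReal (hf0 x)])
  filter_upwards [h] with x hx
  rw [hx, integral_eq_lintegral_of_nonneg_ae (.of_forall hf0) hf.aestronglyMeasurable]

/-- A positive subunital sequentially normal map on an algebra of essentially bounded functions
over a standard Borel space is implemented by a sub-Markov kernel. -/
lemma exists_isImplementedBy [StandardBorelSpace X] (hpos : ∀ c, 0 ≤ c → 0 ≤ P c) (hsub : P 1 ≤ 1)
    (hP : IsSeqNormal P) : ∃ K : Kernel X X, IsSubMarkov K ∧ IsImplementedBy Φ P K := by
  obtain ⟨m, hm, hmP⟩ := exists_isAEMeasureFamily Φ hpos hP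
  obtain ⟨K, hK, hKm⟩ := hm.exists_subMarkov (by
    have h := hmP Set.univ .univ 1 (by
      filter_upwards [Φ.rep_one] with x hx
      simp [hx])
    filter_upwards [h, Φ.le_iff.1 hsub, Φ.rep_one] with x h1 h2 h3
    rw [h1, h3] at h2
    simpa using (Complex.le_def.1 h2).1)
  refine ⟨K, hK, isImplementedBy_of_indicator Φ hpos hP hK fun s hs c hc => ?_⟩
  filter_upwards [hmP s hs c hc, hKm s hs] with x h1 h2
  rw [h1, h2]

end Implementation

/-! ### Path laws and kernel powers -/

section Paths

variable {X : Type*} [MeasurableSpace X] {μ : Measure X}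

lemma isFiniteKernel_pathKernel {K : Kernel X X} [IsFiniteKernel K] (n : ℕ) :
    IsFiniteKernel (pathKernel K n) := by
  induction n with
  | zero => rw [pathKernel]; infer_instance
  | succ n ih => rw [pathKernel]; infer_instance

/-- Each step appends the endpoint last, so coordinate `0` is untouched and its law is only composed
with one more `K`. -/
lemma pathKernel_map_zero {K : Kernel X X} [IsFiniteKernel K] (n : ℕ) :
    (pathKernel K n).map (fun ω => ω 0) = K ^ n := by
  induction n with
  | zero =>
    rw [pathKernel, Kernel.deterministic_map _ (measurable_pi_apply 0), pow_zero]
    rfl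
  | succ n ih =>
    have := isFiniteKernel_pathKernel (K := K) n
    have hsnoc : Measurable fun p : X × (Fin (n + 1) → X) =>
        (Fin.snoc p.2 p.1 : Fin (n + 2) → X) := by
      refine measurable_pi_lambda _ fun i => ?_
      refine Fin.lastCases ?_ (fun j => ?_) i
      · simpa using measurable_fst
      · simpa [Function.comp_def] using (measurable_pi_apply j).comp measurable_snd
    rw [pathKernel, ← Kernel.map_comp_right _ hsnoc (measurable_pi_apply 0)]
    have h1 : (fun ω : Fin (n + 2) → X => ω 0) ∘ (fun p : X × (Fin (n + 1) → X) =>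
        (Fin.snoc p.2 p.1 : Fin (n + 2) → X)) = (fun ω => ω 0) ∘ Prod.snd := by
      funext p
      exact Fin.snoc_castSucc (α := fun _ => X) p.1 p.2 0
    rw [h1, Kernel.map_comp_right _ measurable_snd (measurable_pi_apply 0), ← Kernel.snd_eq,
      Kernel.snd_prod, Kernel.map_comp, ih, pow_succ]
    rfl

lemma hasPositiveMassPath_iff {K : Kernel X X} [IsFiniteKernel K] {A : Set X}
    (hA : MeasurableSet A) (n : ℕ) :
    HasPositiveMassPath μ K A n ↔ μ {x | 0 < (K ^ n) x A} ≠ 0 := by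
  have hS : MeasurableSet {ω : Fin (n + 1) → X | ω 0 ∈ A} := measurable_pi_apply 0 hA
  have h1 : ∀ x, pathKernel K n x {ω | ω 0 ∈ A} = (K ^ n) x A := fun x => by
    rw [← pathKernel_map_zero, Kernel.map_apply' _ (measurable_pi_apply 0) _ hA]
    rfl
  rw [HasPositiveMassPath, Measure.bind_apply hS (Kernel.aemeasurable _)]
  simp only [h1]
  rw [lintegral_pos_iff_support (Kernel.measurable_coe _ hA), pos_iff_ne_zero]
  simp only [pos_iff_ne_zero]
  rfl

end Paths

/-! ### Vanishing of powers in terms of the kernel -/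

section Powers

open Filter

variable {X : Type*} [MeasurableSpace X] {μ : Measure X}
  {C : Type*} [Ring C] [Algebra ℂ C] [Star C] {Φ : LinftyIdentification C μ} {P : C →ₗ[ℂ] C}
  {K : Kernel X X}

/-- The indicator of a null set represents `0`, and `P 0 = 0` settles one step. Inductively, the
points from which `K ^ n` charges `N` form a null set, to which the one-step case applies. -/
lemma IsImplementedBy.ae_measure_eq_zero (hK : IsSubMarkov K) (h : IsImplementedBy Φ P K)
    {N : Set X} (hN : MeasurableSet N) (hN0 : μ N = 0) (n : ℕ) : ∀ᵐ x ∂μ, (K ^ n) x N = 0 := by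
  have : IsFiniteKernel K := hK.isFiniteKernel
  have h1 : ∀ N : Set X, MeasurableSet N → μ N = 0 → ∀ᵐ x ∂μ, K x N = 0 := by
    intro N hN hN0
    have h2 := h (N.indicator 1) (measurable_one.indicator hN)
      (Set.indicator_nonneg fun _ _ => zero_le_one)
      ⟨1, Set.indicator_le_self' (fun _ _ => zero_le_one)⟩ 0 (by
        filter_upwards [Φ.rep_zero, measure_eq_zero_iff_ae_notMem.1 hN0] with x h3 h4
        simp [h3, h4])
    rw [map_zero] at h2
    filter_upwards [h2, Φ.rep_zero] with x h3 h4
    rw [h4, integral_indicator_one hN, Pi.zero_apply, eq_comm, Complex.ofReal_eq_zero] at h3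
    exact (measureReal_eq_zero_iff).1 h3
  induction n with
  | zero =>
    filter_upwards [measure_eq_zero_iff_ae_notMem.1 hN0] with x hx
    rw [pow_zero]
    change Kernel.id x N = 0
    rw [Kernel.id_apply, Measure.dirac_apply' _ hN, Set.indicator_of_notMem hx]
  | succ n ih =>
    have hm := Kernel.measurable_coe (K ^ n) hN
    filter_upwards [h1 {y | (K ^ n) y N ≠ 0} (hm (measurableSet_singleton 0).compl) ih] with x hx
    rw [pow_succ]
    change ((K ^ n) ∘ₖ K) x N = 0
    rw [Kernel.comp_apply' _ _ _ hN, lintegral_eq_zero_iff hm]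
    exact hx

/-- The `n`-step integral of `f` is again measurable, nonnegative and bounded by the same constant,
so the implementation property can be iterated. -/
lemma IsImplementedBy.rep_pow (hK : IsSubMarkov K) (h : IsImplementedBy Φ P K) {f : X → ℝ}
    (hf : Measurable f) (hf0 : ∀ x, 0 ≤ f x) {b : ℝ} (hb : ∀ x, f x ≤ b) {d : C}
    (hd : Φ.rep d =ᵐ[μ] fun x => (f x : ℂ)) (n : ℕ) :
    Φ.rep ((P ^ n) d) =ᵐ[μ]
      fun x => ((∫⁻ y, ENNReal.ofReal (f y) ∂((K ^ n) x)).toReal : ℂ) := by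
  have hm : ∀ n, Measurable fun x => ∫⁻ y, ENNReal.ofReal (f y) ∂((K ^ n) x) :=
    fun n => hf.ennreal_ofReal.lintegral_kernel
  have hle : ∀ n x, ∫⁻ y, ENNReal.ofReal (f y) ∂((K ^ n) x) ≤ ENNReal.ofReal b := fun n x =>
    calc ∫⁻ y, ENNReal.ofReal (f y) ∂((K ^ n) x) ≤ ∫⁻ _, ENNReal.ofReal b ∂((K ^ n) x) :=
          lintegral_mono fun y => ENNReal.ofReal_le_ofReal (hb y)
      _ ≤ ENNReal.ofReal b := by
          rw [lintegral_const]
          exact mul_le_of_le_one_right' (hK.pow n x)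
  induction n with
  | zero =>
    filter_upwards [hd] with x hx
    rw [pow_zero, pow_zero, Module.End.one_apply, hx]
    change _ = ((∫⁻ y, ENNReal.ofReal (f y) ∂(Kernel.id x)).toReal : ℂ)
    rw [Kernel.id_apply, lintegral_dirac' _ hf.ennreal_ofReal, ENNReal.toReal_ofReal (hf0 x)]
  | succ n ih =>
    have h1 := h _ (hm n).ennreal_toReal (fun x => ENNReal.toReal_nonneg)
      ⟨_, fun x => ENNReal.toReal_mono ENNReal.ofReal_ne_top (hle n x)⟩ _ ih
    rw [pow_succ' P, Module.End.mul_apply]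
    filter_upwards [h1] with x hx
    rw [hx, integral_toReal (hm n).aemeasurable
      (.of_forall fun y => (hle n y).trans_lt ENNReal.ofReal_lt_top), pow_succ]
    change _ = ((∫⁻ y, ENNReal.ofReal (f y) ∂(((K ^ n) ∘ₖ K) x)).toReal : ℂ)
    rw [Kernel.lintegral_comp _ _ _ hf.ennreal_ofReal]

lemma IsImplementedBy.pow_eq_zero_iff (hK : IsSubMarkov K) (h : IsImplementedBy Φ P K) {f : X → ℝ}
    (hf : Measurable f) (hf0 : ∀ x, 0 ≤ f x) {b : ℝ} (hb : ∀ x, f x ≤ b) {d : C}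
    (hd : Φ.rep d =ᵐ[μ] fun x => (f x : ℂ)) {A : Set X} (hA : MeasurableSet A)
    (hAd : A =ᵐ[μ] Function.support (Φ.rep d)) (n : ℕ) :
    (P ^ n) d = 0 ↔ μ {x | 0 < (K ^ n) x A} = 0 := by
  have hfin : IsFiniteKernel (K ^ n) := (hK.pow n).isFiniteKernel
  have hB : MeasurableSet (Function.support f) := measurableSet_support hf
  have hAB : A =ᵐ[μ] Function.support f := by
    filter_upwards [hAd, hd] with x h1 h2
    refine h1.trans (propext ?_)
    change Φ.rep d x ≠ 0 ↔ f x ≠ 0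
    rw [h2, Ne, Complex.ofReal_eq_zero]
  have h1 : ∀ᵐ x ∂μ, ((K ^ n) x A = 0 ↔ (K ^ n) x (Function.support f) = 0) := by
    filter_upwards [h.ae_measure_eq_zero hK (hA.diff hB) (ae_le_set.1 hAB.le) n,
      h.ae_measure_eq_zero hK (hB.diff hA) (ae_le_set.1 hAB.symm.le) n] with x h2 h3
    exact ⟨fun h4 => measure_mono_null_ae (ae_le_set.2 h3) h4,
      fun h4 => measure_mono_null_ae (ae_le_set.2 h2) h4⟩
  have h2 : (P ^ n) d = 0 ↔ ∀ᵐ x ∂μ, (K ^ n) x (Function.support f) = 0 := by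
    have h3 : (P ^ n) d = 0 ↔ Φ.rep ((P ^ n) d) =ᵐ[μ] 0 :=
      ⟨fun h4 => h4 ▸ Φ.rep_zero, fun h4 => Φ.eq_of_rep_ae_eq (h4.trans Φ.rep_zero.symm)⟩
    rw [h3]
    refine eventually_congr ?_
    filter_upwards [h.rep_pow hK hf hf0 hb hd n] with x hx
    have h4 : ∫⁻ y, ENNReal.ofReal (f y) ∂((K ^ n) x) ≠ ∞ :=
      ((lintegral_mono fun y => ENNReal.ofReal_le_ofReal (hb y)).trans_lt (by
        rw [lintegral_const]
        exact ENNReal.mul_lt_top ENNReal.ofReal_lt_top (measure_lt_top _ _))).ne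
    rw [hx, Pi.zero_apply, Complex.ofReal_eq_zero, ENNReal.toReal_eq_zero_iff, or_iff_left h4,
      lintegral_eq_zero_iff hf.ennreal_ofReal]
    have h5 : Function.support f = {y | ¬ (ENNReal.ofReal (f y) = 0)} := by
      ext y
      simp [(hf0 y).lt_iff_ne', Function.mem_support]
    rw [h5]
    rfl
  rw [h2, ← eventually_congr h1, ae_iff]
  simp only [pos_iff_ne_zero]

end Powers

/-! ### The induced map on `C` -/

section InducedMap

variable {H : Type*} [NormedAddCommGroup H] [InnerProductSpace ℂ H] [CompleteSpace H]
  {M C : VonNeumannAlgebra H} {hCM : C.toStarSubalgebra ≤ M.toStarSubalgebra}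
  {T : M.toStarSubalgebra →ₗ[ℂ] M.toStarSubalgebra}
  {E : M.toStarSubalgebra →ₗ[ℂ] C.toStarSubalgebra}

lemma inducedMap_nonneg (hTpos : ∀ x, 0 ≤ x → 0 ≤ T x) (hE : IsConditionalExpectation hCM E)
    (c : C.toStarSubalgebra) (hc : 0 ≤ c) : 0 ≤ inducedMap hCM T E c :=
  hE.map_nonneg _ (hTpos _ (inclusion_nonneg hCM hc))

lemma inducedMap_one_le (hTsub : T 1 ≤ 1) (hE : IsConditionalExpectation hCM E) :
    inducedMap hCM T E 1 ≤ 1 := by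
  have h1 : E 1 = 1 := by
    have := hE.map_incl 1
    rwa [map_one] at this
  have h2 := hE.map_nonneg (1 - T 1)
    (sub_nonneg.2 (show (T 1 : H →L[ℂ] H) ≤ (1 : M.toStarSubalgebra) from hTsub))
  rw [map_sub, h1] at h2
  have h3 : inducedMap hCM T E 1 = E (T 1) := by
    change E (T (StarSubalgebra.inclusion hCM 1)) = _
    rw [map_one]
  rw [h3]
  exact sub_nonneg.1 (show (0 : H →L[ℂ] H) ≤
    ((1 : C.toStarSubalgebra) : H →L[ℂ] H) - (E (T 1) : H →L[ℂ] H) from h2)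

lemma defect_nonneg (hTsub : T 1 ≤ 1) : 0 ≤ defect T :=
  sub_nonneg.2 (show (T 1 : H →L[ℂ] H) ≤ (1 : M.toStarSubalgebra) from hTsub)

lemma IsNormalMap.isGLB_range {A B : Type*} [PartialOrder A] [PartialOrder B] {f : A → B}
    (hf : IsNormalMap f) {c : ℕ → A} (hc : Antitone c) {a : A} (h : IsGLB (Set.range c) a) :
    IsGLB (Set.range fun n => f (c n)) (f a) := by
  have h1 := hf (Set.range c) (Set.range_nonempty c) (directedOn_range.2 hc.directed_ge) a h
  rwa [← Set.range_comp] at h1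

/-- Normality of `T` concerns infima in `M`; `isGLB_range_inclusion` supplies them for sequences
from `C`. -/
lemma isSeqNormal_inducedMap (hTpos : ∀ x, 0 ≤ x → 0 ≤ T x) (hTnormal : IsNormalMap T)
    (hEnormal : IsNormalMap E) : IsSeqNormal (inducedMap hCM T E) := by
  intro c hc h
  have h1 := hTnormal.isGLB_range (c := fun n => StarSubalgebra.inclusion hCM (c n))
    (fun m n hmn => hc hmn) (isGLB_range_inclusion hCM hc h)
  have h2 := hEnormal.isGLB_range (fun m n hmn => map_mono_of_nonneg hTpos (hc hmn)) h1
  rwa [map_zero, map_zero] at h2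

lemma coe_inducedMap_pow (hE : IsConditionalExpectation hCM E) {d : C.toStarSubalgebra}
    (horbit : ∀ k : ℕ, (((T ^ k) (StarSubalgebra.inclusion hCM d) : M.toStarSubalgebra) :
      H →L[ℂ] H) ∈ C) (k : ℕ) :
    StarSubalgebra.inclusion hCM ((inducedMap hCM T E ^ k) d) =
      (T ^ k) (StarSubalgebra.inclusion hCM d) := by
  induction k with
  | zero => simp
  | succ k ih =>
    have h1 : (inducedMap hCM T E ^ (k + 1)) d =
        E ((T ^ (k + 1)) (StarSubalgebra.inclusion hCM d)) := by
      rw [pow_succ', pow_succ', Module.End.mul_apply, Module.End.mul_apply, ← ih]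
      rfl
    have h2 : (T ^ (k + 1)) (StarSubalgebra.inclusion hCM d) =
        StarSubalgebra.inclusion hCM ⟨_, horbit (k + 1)⟩ := rfl
    rw [h1, h2, hE.map_incl]

lemma stabilizationIndex_lt_top_iff :
    stabilizationIndex T < ⊤ ↔ ∃ n : ℕ, 1 ≤ n ∧ (T ^ n) (defect T) = 0 := by
  rw [stabilizationIndex, sInf_lt_iff]
  constructor
  · rintro ⟨m, ⟨n, h1, h2, rfl⟩, -⟩
    exact ⟨n, h1, h2⟩
  · rintro ⟨n, h1, h2⟩
    exact ⟨n, ⟨n, h1, h2, rfl⟩, ENat.natCast_lt_top n⟩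

end InducedMap

end OrbitTrapping

end

/-! ### The main theorem -/

theorem mainTheorem9
    {H : Type*} [NormedAddCommGroup H] [InnerProductSpace ℂ H] [CompleteSpace H]
    -- a von Neumann algebra and a von Neumann subalgebra
    (M C : VonNeumannAlgebra H) (hCM : C.toStarSubalgebra ≤ M.toStarSubalgebra)
    -- a normal positive subunital map
    (T : M.toStarSubalgebra →ₗ[ℂ] M.toStarSubalgebra)
    (hTpos : ∀ x, 0 ≤ x → 0 ≤ T x) (hTsub : T 1 ≤ 1) (hTnormal : OrbitTrapping.IsNormalMap T)
    -- a normal conditional expectation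
    (E : M.toStarSubalgebra →ₗ[ℂ] C.toStarSubalgebra)
    (hE : OrbitTrapping.IsConditionalExpectation hCM E) (hEnormal : OrbitTrapping.IsNormalMap E)
    -- the orbit condition
    (horbit : ∀ k : ℕ, (((T ^ k) (OrbitTrapping.defect T) : M.toStarSubalgebra) : H →L[ℂ] H) ∈ C)
    -- an identification of `C` with an algebra `L^∞(X, μ)`
    {X : Type*} [MeasurableSpace X] (μ : Measure X)
    (Φ : OrbitTrapping.LinftyIdentification C.toStarSubalgebra μ) :
    ∃ d : C.toStarSubalgebra, (d : H →L[ℂ] H) = OrbitTrapping.defect T ∧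
      (∀ k : ℕ, (((OrbitTrapping.inducedMap hCM T E ^ k) d : C.toStarSubalgebra) : H →L[ℂ] H) =
        (T ^ k) (OrbitTrapping.defect T)) ∧
      (StandardBorelSpace X → SFinite μ → ∃ K : Kernel X X, OrbitTrapping.IsSubMarkov K ∧
        OrbitTrapping.IsImplementedBy Φ (OrbitTrapping.inducedMap hCM T E) K) ∧
      ∀ K : Kernel X X, OrbitTrapping.IsSubMarkov K →
        OrbitTrapping.IsImplementedBy Φ (OrbitTrapping.inducedMap hCM T E) K →
        ∀ A : Set X, MeasurableSet A →
          A =ᵐ[μ] Function.support (Φ.rep d) →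
          (∀ n : ℕ, (OrbitTrapping.inducedMap hCM T E ^ n) d = 0 ↔
            μ {x | 0 < (K ^ n) x A} = 0) ∧
          (OrbitTrapping.stabilizationIndex T < ⊤ ↔
            ∃ N : ℕ, ∀ n : ℕ, OrbitTrapping.HasPositiveMassPath μ K A n → n ≤ N) := by
  obtain ⟨d, hd⟩ : ∃ d : C.toStarSubalgebra,
      StarSubalgebra.inclusion hCM d = OrbitTrapping.defect T := ⟨⟨_, horbit 0⟩, rfl⟩
  have hpow := OrbitTrapping.coe_inducedMap_pow (T := T) hE (d := d) (by rwa [hd])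
  rw [hd] at hpow
  have hpos := OrbitTrapping.inducedMap_nonneg hTpos hE
  have hd0 : 0 ≤ d := by
    have h : 0 ≤ StarSubalgebra.inclusion hCM d := hd ▸ OrbitTrapping.defect_nonneg hTsub
    exact h
  refine ⟨d, congrArg Subtype.val hd, fun k => congrArg Subtype.val (hpow k), ?_, ?_⟩
  · intro _ _
    exact OrbitTrapping.exists_isImplementedBy Φ hpos (OrbitTrapping.inducedMap_one_le hTsub hE)
      (OrbitTrapping.isSeqNormal_inducedMap hTpos hTnormal hEnormal)
  · intro K hK hKP A hA hAd
    have hfin : IsFiniteKernel K := hK.isFiniteKernel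
    obtain ⟨f, hf, hf0, ⟨b, hb⟩, hfd⟩ := Φ.exists_bounded_rep hd0
    have hzero := hKP.pow_eq_zero_iff hK hf hf0 hb hfd hA hAd
    refine ⟨hzero, ?_⟩
    have hpath : ∀ n, OrbitTrapping.HasPositiveMassPath μ K A n ↔
        (T ^ n) (OrbitTrapping.defect T) ≠ 0 := fun n => by
      rw [OrbitTrapping.hasPositiveMassPath_iff hA, Ne, ← hzero n, ← hpow n]
      exact not_congr (map_eq_zero_iff _ (StarSubalgebra.inclusion_injective hCM)).symm
    rw [OrbitTrapping.stabilizationIndex_lt_top_iff]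
    constructor
    · rintro ⟨N, -, hN⟩
      refine ⟨N, fun n hn => ?_⟩
      by_contra! hlt
      refine (hpath n).1 hn ?_
      -- Once the orbit is `0` at time `N`, it is `0` at every later time.
      rw [← Nat.sub_add_cancel hlt.le, pow_add, Module.End.mul_apply, hN, map_zero]
    · rintro ⟨N, hN⟩
      -- The successor lies beyond the path bound and also meets the requirement `n ≥ 1` when `N =
      -- 0`.
      refine ⟨N + 1, by omega, ?_⟩
      by_contra h
      have := hN (N + 1) ((hpath _).2 h)
      omega
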